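/- Let $Q$ be a finite-dimensional smooth manifold and let $\Phi\colon G\times Q\to Q$, $(g,q)\mapsto gq=\Phi_g(q)$, be a smooth, free and proper left action of a finite-dimensional Lie group $G$ with Lie algebra $\mathfrak g$. For $\xi\in\mathfrak g$ let $\xi_Q(q)=\frac{d}{dt}\big|_{t=0}\exp(t\xi)\,q$ be its infinitesimal generator and $J_\xi\colon T^*Q\to\mathbb R$, $J_\xi(\alpha_q)=\langle\alpha_q,\xi_Q(q)\rangle$, the corresponding component of the momentum map of the cotangent-lifted action. A discretization map is a smooth map $R_d=(R^1,R^2)\colon U\to Q\times Q$ on an open neighbourhood $U\subseteq TQ$ of the zero section such that, for all $x\in Q$, $R_d(0_x)=(x,x)$ and $T_{0_x}(R^2|_{T_xQ\cap U})-T_{0_x}(R^1|_{T_xQ\cap U})=\mathrm{id}_{T_xQ}$ (with $T_{0_x}T_xQ\simeq T_xQ$). It is symmetry-preserving if $R_d(T_q\Phi_g(v_q))=(\Phi_g\times\Phi_g)(R_d(v_q))$ for all $g\in G$ and all $v_q\in U$ with $T_q\Phi_g(v_q)\in U$. Let $\omega_Q=dq^i\wedge dp_i$ be the canonical symplectic form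 of $T^*Q$. For a smooth Hamiltonian $H\colon T^*Q\to\mathbb R$ let $X_H$ be defined by $i_{X_H}\omega_Q=dH$. Let $\mathcal I_{TQ}\colon T^*T^*Q\to T^*TQ$ be the canonical antisymplectomorphism, given in natural coordinates by $(q,p,\mu_q,\mu_p)\mapsto(q,\mu_p,-\mu_q,p)$. The cotangent lift $T^*R_d$ sends $\lambda\in T^*_v(TQ)$, $v\in U$, to the covector $\varphi\in T^*_{R_d(v)}(Q\times Q)$ with $\varphi\circ T_vR_d=\lambda$ (at a point $v$ where $T_vR_d$ is not invertible, $\lambda$ is related to every such $\varphi$, if any). For $h>0$ put $$D^h_H=(T^*R_d\circ\mathcal I_{TQ})(h\,\mathrm{Im}\,dH)\subseteq T^*(Q\times Q)\simeq T^*Q\times T^*Q,$$ where $h$ acts by multiplication in the fibres of $T^*T^*Q$. **Theorem.** Let $R_d$ be a symmetry-preserving discretization map, $H\colon T^*Q\to\mathbb R$ a smooth Hamiltonian, and $\xi\in\mathfrak g$ such that $J_\xi$ is a constant of motion of $X_H$, i.e. $X_H(J_\xi)=0$. Then for every $h>0$ the discrete dynamics given by $D^h_H$ preserves $J_\xi$: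 $$J_\xi(\mu_{q_k})=J_\xi(\mu_{q_{k+1}})\qquad\text{whenever }(-\mu_{q_k},\mu_{q_{k+1}})\in D^h_H.$$ -/

import Mathlib

open Bundle Set
open scoped Manifold ContDiff Topology

noncomputable section

/-! ### Lie groups: exponential map and infinitesimal generators -/

section Exponential

variable {F : Type*} [NormedAddCommGroup F] [NormedSpace ℝ F]
  {G : Type*} [TopologicalSpace G] [ChartedSpace F G] [Group G] [LieGroup 𝓘(ℝ, F) ∞ G]

/-- Left translations preserve left-invariant vector fields. -/
theorem mulInvariantVectorField_mul (ξ : GroupLieAlgebra 𝓘(ℝ, F) G) (g k : G) :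
    mulInvariantVectorField (I := 𝓘(ℝ, F)) ξ (g * k) =
      mfderiv 𝓘(ℝ, F) 𝓘(ℝ, F) (fun x : G => g * x) k
        (mulInvariantVectorField (I := 𝓘(ℝ, F)) ξ k) := by
  have hd (a b : G) : MDifferentiableAt 𝓘(ℝ, F) 𝓘(ℝ, F) (fun x : G => a * x) b :=
    (contMDiff_mul_left (I := 𝓘(ℝ, F)) (n := ∞)).mdifferentiableAt (by simp)
  have e : (fun x : G => g * k * x) = (fun x : G => g * x) ∘ (fun x : G => k * x) := by
    funext x; simp [mul_assoc]
  unfold mulInvariantVectorField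
  rw [e]
  exact mfderiv_comp_apply_of_eq (I := 𝓘(ℝ, F)) (I' := 𝓘(ℝ, F)) (I'' := 𝓘(ℝ, F))
    (x := (1 : G)) (y := k) (hd g k) (hd k 1) (mul_one k) ξ

/-- Left translates of integral curves of a left-invariant vector field are integral curves. -/
theorem isMIntegralCurveOn_mul_left {ξ : GroupLieAlgebra 𝓘(ℝ, F) G} {γ : ℝ → G} {s : Set ℝ}
    (hγ : IsMIntegralCurveOn γ (mulInvariantVectorField (I := 𝓘(ℝ, F)) ξ) s) (g : G) :
    IsMIntegralCurveOn (fun t => g * γ t) (mulInvariantVectorField (I := 𝓘(ℝ, F)) ξ) s := by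
  intro t ht
  have hd : MDifferentiableAt 𝓘(ℝ, F) 𝓘(ℝ, F) (fun x : G => g * x) (γ t) :=
    (contMDiff_mul_left (I := 𝓘(ℝ, F)) (n := ∞)).mdifferentiableAt (by simp)
  have h1 := hd.hasMFDerivAt.comp_hasMFDerivWithinAt t (hγ t ht)
  rw [mulInvariantVectorField_mul]
  exact h1.congr_mfderiv (ContinuousLinearMap.ext fun r =>
    (mfderiv 𝓘(ℝ, F) 𝓘(ℝ, F) (fun x : G => g * x) (γ t)).map_smul r
      (mulInvariantVectorField (I := 𝓘(ℝ, F)) ξ (γ t)))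

/-- Left-invariant vector fields are complete: the integral curve through the identity is
defined on all of `ℝ`. -/
theorem exists_isMIntegralCurve_mulInvariantVectorField [FiniteDimensional ℝ F] [T2Space G]
    (ξ : GroupLieAlgebra 𝓘(ℝ, F) G) :
    ∃ γ : ℝ → G, γ 0 = 1 ∧ IsMIntegralCurve γ (mulInvariantVectorField (I := 𝓘(ℝ, F)) ξ) := by
  have : CompleteSpace F := FiniteDimensional.complete ℝ F
  have hsm : minSmoothness ℝ 3 ≤ (∞ : WithTop ℕ∞) := by
    simpa using WithTop.coe_le_coe.2 (le_top : (3 : ℕ∞) ≤ ⊤)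
  have : LieGroup 𝓘(ℝ, F) (minSmoothness ℝ 3) G := LieGroup.of_le hsm
  have : IsManifold 𝓘(ℝ, F) 1 G := IsManifold.of_le (n := ∞) (by simp)
  have hv := (contMDiff_mulInvariantVectorField (I := 𝓘(ℝ, F)) (G := G) ξ).of_le
    (n := minSmoothness ℝ 2) (m := 1) (by simp)
  obtain ⟨γ, h0, hγ⟩ := exists_isMIntegralCurveAt_of_contMDiffAt_boundaryless 0 (hv 1)
  rw [isMIntegralCurveAt_iff'] at hγ
  obtain ⟨ε, hε, hγ⟩ := hγ
  rw [Real.ball_eq_Ioo, zero_sub, zero_add] at hγ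
  exact exists_isMIntegralCurve_of_isMIntegralCurveOn hv hε
    (fun x => ⟨fun t => x * γ t, by simp [h0], isMIntegralCurveOn_mul_left hγ x⟩) 1

/-- The exponential map `exp : 𝔤 → G`: the value at time `1` of the integral curve, starting at
the identity, of the left-invariant vector field of `ξ` (this curve exists and is unique). -/
def lieExp [FiniteDimensional ℝ F] [T2Space G] (ξ : GroupLieAlgebra 𝓘(ℝ, F) G) : G :=
  (exists_isMIntegralCurve_mulInvariantVectorField ξ).choose 1

end Exponential

section Generator

variable {F : Type*} [NormedAddCommGroup F] [NormedSpace ℝ F] [FiniteDimensional ℝ F]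
  {G : Type*} [TopologicalSpace G] [T2Space G] [ChartedSpace F G] [Group G]
  [LieGroup 𝓘(ℝ, F) ∞ G]
  {E : Type*} [NormedAddCommGroup E] [NormedSpace ℝ E]
  {Q : Type*} [TopologicalSpace Q] [ChartedSpace E Q] [MulAction G Q]

/-- The infinitesimal generator `ξ_Q(q) = d/dt|_{t = 0} exp(tξ) • q` of the action. -/
def infinitesimalGenerator (ξ : GroupLieAlgebra 𝓘(ℝ, F) G) (q : Q) : TangentSpace 𝓘(ℝ, E) q :=
  (mfderiv 𝓘(ℝ, ℝ) 𝓘(ℝ, E) (fun t : ℝ => lieExp (t • ξ) • q) 0 (1 : ℝ) : E)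

end Generator

/-! ### Cotangent bundles and the canonical Hamiltonian structure -/

/-- The cotangent bundle `T^*M`; a point is a pair of `x : M` and a covector at `x`. Its topology
and its charted space structure are those of Mathlib's bundles of continuous linear maps. -/
abbrev CotangentBundle {E H : Type*} [NormedAddCommGroup E] [NormedSpace ℝ E] [TopologicalSpace H]
    (I : ModelWithCorners ℝ E H) (M : Type*) [TopologicalSpace M] [ChartedSpace H M] : Type _ :=
  TotalSpace (E →L[ℝ] ℝ) (fun x : M => TangentSpace I x →L[ℝ] ℝ)

/-- The model with corners of the manifold `T^*Q`, for `Q` modelled on `E`. -/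
abbrev cotangentModel (E : Type*) [NormedAddCommGroup E] [NormedSpace ℝ E] :
    ModelWithCorners ℝ (E × (E →L[ℝ] ℝ)) (ModelProd E (E →L[ℝ] ℝ)) :=
  𝓘(ℝ, E).prod 𝓘(ℝ, E →L[ℝ] ℝ)

/-- The fibrewise multiplication by a real number on a cotangent bundle. -/
def fiberSmul {E H : Type*} [NormedAddCommGroup E] [NormedSpace ℝ E] [TopologicalSpace H]
    {I : ModelWithCorners ℝ E H} {M : Type*} [TopologicalSpace M] [ChartedSpace H M]
    (c : ℝ) (α : CotangentBundle I M) : CotangentBundle I M :=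
  ⟨α.proj, c • (α.snd : TangentSpace I α.proj →L[ℝ] ℝ)⟩

/-- The differential `df` of a real function, as a map from the manifold to its cotangent
bundle. -/
def differential {E H : Type*} [NormedAddCommGroup E] [NormedSpace ℝ E] [TopologicalSpace H]
    (I : ModelWithCorners ℝ E H) {M : Type*} [TopologicalSpace M] [ChartedSpace H M]
    (f : M → ℝ) (x : M) : CotangentBundle I M :=
  ⟨x, (mfderiv I 𝓘(ℝ, ℝ) f x : E →L[ℝ] ℝ)⟩

/-- The canonical isomorphism `E ≃ E^**` for a finite-dimensional `E`. -/
def bidualEquiv (E : Type*) [NormedAddCommGroup E] [NormedSpace ℝ E] [FiniteDimensional ℝ E] :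
    E ≃ₗ[ℝ] ((E →L[ℝ] ℝ) →L[ℝ] ℝ) :=
  (Module.evalEquiv ℝ E).trans
    ((LinearMap.toContinuousLinearMap (𝕜 := ℝ) (E := E) (F' := ℝ)).symm.dualMap.trans
      LinearMap.toContinuousLinearMap)

theorem bidualEquiv_apply {E : Type*} [NormedAddCommGroup E] [NormedSpace ℝ E]
    [FiniteDimensional ℝ E] (v : E) (p : E →L[ℝ] ℝ) : bidualEquiv E v p = p v := rfl

section Canonical

variable {E : Type*} [NormedAddCommGroup E] [NormedSpace ℝ E]
  {Q : Type*} [TopologicalSpace Q] [ChartedSpace E Q] [IsManifold 𝓘(ℝ, E) ∞ Q]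

/- In Mathlib the tangent space `T_α(T^*Q)` at `α = (q, p)` is the model space `E × E^*`: a tangent
vector is given by its components `(δq, δp)` in the natural chart `(q, p)` of `T^*Q` induced by the
preferred chart of `Q` at the base point of `α`. In the same way `T_v(TQ)` is `E × E`, with
components `(δq, δv)` in the natural chart of `TQ` induced by the preferred chart at the base point
of `v`. The covector and the vector of a point are their own coordinates in these charts. -/

/-- The canonical symplectic form `ω_Q = dq ∧ dp` of `T^*Q`. -/
def canonicalSymplecticForm (α : CotangentBundle 𝓘(ℝ, E) Q)
    (w w' : TangentSpace (cotangentModel E) α) : ℝ :=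
  let a : E × (E →L[ℝ] ℝ) := w
  let b : E × (E →L[ℝ] ℝ) := w'
  b.2 a.1 - a.2 b.1

/-- The Hamiltonian vector field `X_H = (∂H/∂p, -∂H/∂q)`, the vector field with
`i_{X_H} ω_Q = dH`. -/
def hamiltonianVectorField [FiniteDimensional ℝ E] (H : CotangentBundle 𝓘(ℝ, E) Q → ℝ)
    (α : CotangentBundle 𝓘(ℝ, E) Q) : TangentSpace (cotangentModel E) α :=
  let dH : E × (E →L[ℝ] ℝ) →L[ℝ] ℝ := (differential (cotangentModel E) H α).snd
  (((bidualEquiv E).symm (dH.comp (.inr ℝ E (E →L[ℝ] ℝ))),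
    -dH.comp (.inl ℝ E (E →L[ℝ] ℝ))) : E × (E →L[ℝ] ℝ))

theorem canonicalSymplecticForm_hamiltonianVectorField [FiniteDimensional ℝ E]
    (H : CotangentBundle 𝓘(ℝ, E) Q → ℝ) (α : CotangentBundle 𝓘(ℝ, E) Q)
    (w : TangentSpace (cotangentModel E) α) :
    canonicalSymplecticForm α (hamiltonianVectorField H α) w =
      (differential (cotangentModel E) H α).snd w := by
  let dH : E × (E →L[ℝ] ℝ) →L[ℝ] ℝ := (differential (cotangentModel E) H α).snd
  let b : E × (E →L[ℝ] ℝ) := w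
  change b.2 ((bidualEquiv E).symm (dH.comp (.inr ℝ E (E →L[ℝ] ℝ)))) -
    (-dH.comp (.inl ℝ E (E →L[ℝ] ℝ))) b.1 = dH b
  rw [← bidualEquiv_apply, LinearEquiv.apply_symm_apply]
  have : dH b = dH (b.1, 0) + dH (0, b.2) := by rw [← map_add]; simp
  rw [this]
  simp [add_comm]

/-- `f` is a constant of motion of `X_H`: `X_H(f) = 0`. -/
def IsConstantOfMotion [FiniteDimensional ℝ E] (H f : CotangentBundle 𝓘(ℝ, E) Q → ℝ) : Prop :=
  ∀ α, (differential (cotangentModel E) f α).snd (hamiltonianVectorField H α) = 0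

/-- The canonical antisymplectomorphism `I_{TQ} : T^*T^*Q → T^*TQ`,
`(q, p, μ_q, μ_p) ↦ (q, μ_p, -μ_q, p)`, where `μ_p ∈ E^**` is regarded as a vector. -/
def canonicalFlip [FiniteDimensional ℝ E]
    (Λ : CotangentBundle (cotangentModel E) (CotangentBundle 𝓘(ℝ, E) Q)) :
    CotangentBundle 𝓘(ℝ, E).tangent (TangentBundle 𝓘(ℝ, E) Q) :=
  let p : E →L[ℝ] ℝ := Λ.proj.snd
  let μ : E × (E →L[ℝ] ℝ) →L[ℝ] ℝ := Λ.snd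
  let μq : E →L[ℝ] ℝ := μ.comp (.inl ℝ E (E →L[ℝ] ℝ))
  let μp : (E →L[ℝ] ℝ) →L[ℝ] ℝ := μ.comp (.inr ℝ E (E →L[ℝ] ℝ))
  ⟨⟨Λ.proj.proj, (bidualEquiv E).symm μp⟩, ((-μq).coprod p : E × E →L[ℝ] ℝ)⟩

end Canonical

/-! ### Momentum, discretization maps and the discrete dynamics -/

section Discretization

variable {E : Type*} [NormedAddCommGroup E] [NormedSpace ℝ E]
  {Q : Type*} [TopologicalSpace Q] [ChartedSpace E Q]

/-- The momentum component `J_ξ(α_q) = ⟨α_q, ξ_Q(q)⟩`. -/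
def momentumComponent {F : Type*} [NormedAddCommGroup F] [NormedSpace ℝ F] [FiniteDimensional ℝ F]
    {G : Type*} [TopologicalSpace G] [T2Space G] [ChartedSpace F G] [Group G]
    [LieGroup 𝓘(ℝ, F) ∞ G] [MulAction G Q]
    (ξ : GroupLieAlgebra 𝓘(ℝ, F) G) (α : CotangentBundle 𝓘(ℝ, E) Q) : ℝ :=
  α.snd (infinitesimalGenerator ξ α.proj)

/-- The pair `(μ, ν) ∈ T^*Q × T^*Q` as a covector of `Q × Q`:
`(δq, δq') ↦ ⟨μ, δq⟩ + ⟨ν, δq'⟩`. -/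
def covectorPair (μ ν : CotangentBundle 𝓘(ℝ, E) Q) :
    CotangentBundle (𝓘(ℝ, E).prod 𝓘(ℝ, E)) (Q × Q) :=
  ⟨(μ.proj, ν.proj), ((μ.snd : E →L[ℝ] ℝ).coprod (ν.snd : E →L[ℝ] ℝ) : E × E →L[ℝ] ℝ)⟩

variable [IsManifold 𝓘(ℝ, E) ∞ Q]

/-- `R : U ⊆ TQ → Q × Q` is a discretization map (the values of `R` outside `U` play no role). -/
structure IsDiscretizationMap (U : Set (TangentBundle 𝓘(ℝ, E) Q))
    (R : TangentBundle 𝓘(ℝ, E) Q → Q × Q) : Prop where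
  isOpen : IsOpen U
  zero_mem : ∀ x : Q, (⟨x, 0⟩ : TangentBundle 𝓘(ℝ, E) Q) ∈ U
  contMDiffOn : ContMDiffOn 𝓘(ℝ, E).tangent (𝓘(ℝ, E).prod 𝓘(ℝ, E)) ∞ R U
  apply_zero : ∀ x : Q, R ⟨x, 0⟩ = (x, x)
  /-- `T_{0_x} R²_x - T_{0_x} R¹_x = id` on `T_x Q`. -/
  rigidity : ∀ (x : Q) (w : E),
    let D₁ : E := mfderiv 𝓘(ℝ, E) 𝓘(ℝ, E) (fun v : E => (R ⟨x, v⟩).1) 0 w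
    let D₂ : E := mfderiv 𝓘(ℝ, E) 𝓘(ℝ, E) (fun v : E => (R ⟨x, v⟩).2) 0 w
    D₂ - D₁ = w

/-- `R` is symmetry-preserving: `R(TΦ_g(v)) = (Φ_g × Φ_g)(R(v))`, whenever both sides are
defined. -/
def IsSymmetryPreserving (G : Type*) [Group G] [MulAction G Q]
    (U : Set (TangentBundle 𝓘(ℝ, E) Q)) (R : TangentBundle 𝓘(ℝ, E) Q → Q × Q) : Prop :=
  ∀ (g : G), ∀ v ∈ U, tangentMap 𝓘(ℝ, E) 𝓘(ℝ, E) (fun q : Q => g • q) v ∈ U →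
    R (tangentMap 𝓘(ℝ, E) 𝓘(ℝ, E) (fun q : Q => g • q) v) = (g • (R v).1, g • (R v).2)

/-- The cotangent lift `T^*R` of `R : U ⊆ TQ → Q × Q`, as a relation: `lam ∈ T_v^*(TQ)`, `v ∈ U`, is
related to the covectors `φ` at `R(v)` with `(T_vR)^* φ = lam`. Wherever `T_vR` is invertible this
says `φ = lam ∘ (T_vR)⁻¹`. -/
def IsCotangentLift (U : Set (TangentBundle 𝓘(ℝ, E) Q)) (R : TangentBundle 𝓘(ℝ, E) Q → Q × Q)
    (lam : CotangentBundle 𝓘(ℝ, E).tangent (TangentBundle 𝓘(ℝ, E) Q))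
    (β : CotangentBundle (𝓘(ℝ, E).prod 𝓘(ℝ, E)) (Q × Q)) : Prop :=
  lam.proj ∈ U ∧ ∃ φ : TangentSpace (𝓘(ℝ, E).prod 𝓘(ℝ, E)) (R lam.proj) →L[ℝ] ℝ,
    β = ⟨R lam.proj, φ⟩ ∧
      φ.comp (mfderiv 𝓘(ℝ, E).tangent (𝓘(ℝ, E).prod 𝓘(ℝ, E)) R lam.proj) = lam.snd

/-- `D^h_H = (T^*R ∘ I_{TQ})(h Im dH) ⊆ T^*(Q × Q)`. -/
def discreteDynamics [FiniteDimensional ℝ E] (U : Set (TangentBundle 𝓘(ℝ, E) Q))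
    (R : TangentBundle 𝓘(ℝ, E) Q → Q × Q) (H : CotangentBundle 𝓘(ℝ, E) Q → ℝ) (h : ℝ) :
    Set (CotangentBundle (𝓘(ℝ, E).prod 𝓘(ℝ, E)) (Q × Q)) :=
  {β | ∃ Λ ∈ fiberSmul h '' range (differential (cotangentModel E) H),
    IsCotangentLift U R (canonicalFlip Λ) β}

end Discretization

end

/-! A point of the discrete dynamics comes from some `α = (q, p)`: it is a covector `φ = (-μ, ν)` at
`R v` with `φ ∘ T_vR = λ`, where `v = (q, h ∂H/∂p)` and `λ = (-h ∂H/∂q, p)`. The proof evaluates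
this identity on the velocity at `v` of the tangent-lifted flow of `ξ`, which in natural coordinates
is `(ξ_Q(q), Dξ_Q(q) v)` (`hasMFDerivAt_tangentMap_lieExp_smul`).

Differentiating the equivariance of `R` along `exp(tξ)` shows that `T_vR` sends this velocity to
`(ξ_Q(R¹ v), ξ_Q(R² v))` (`IsSymmetryPreserving.mfderiv_infinitesimalGenerator`), so `φ` yields
`J_ξ(ν) - J_ξ(μ)`. On the other side `λ` yields `h (p(Dξ_Q ∂H/∂p) - ∂H/∂q(ξ_Q))`. Since `dJ_ξ = p ∘
Dξ_Q dq + ξ_Q dp` (`hasMFDerivAt_momentumComponent`), this is `h X_H(J_ξ)(α) = 0`.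

The analytic point is that the same `Dξ_Q` occurs twice: in the lifted flow the action is
differentiated first in `q` and then in `t`, in `dJ_ξ` in the opposite order. Symmetry of second
derivatives identifies the two (`fderiv_generatorInChart`). -/

/-! ### The one-parameter subgroup of a Lie algebra element -/

section Exponential

variable {F : Type*} [NormedAddCommGroup F] [NormedSpace ℝ F] [FiniteDimensional ℝ F]
  {G : Type*} [TopologicalSpace G] [T2Space G] [ChartedSpace F G] [Group G]
  [LieGroup 𝓘(ℝ, F) ∞ G]

/-- The curve `t ↦ exp (t ξ)` is the integral curve of the left-invariant vector field of `ξ`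
starting at the identity. -/
theorem lieExp_smul_eq (ξ : GroupLieAlgebra 𝓘(ℝ, F) G) :
    (fun t : ℝ => lieExp (t • ξ)) =
      (exists_isMIntegralCurve_mulInvariantVectorField (G := G) ξ).choose := by
  have : CompleteSpace F := FiniteDimensional.complete ℝ F
  have hsm : minSmoothness ℝ 3 ≤ (∞ : WithTop ℕ∞) := by
    simpa using WithTop.coe_le_coe.2 (le_top : (3 : ℕ∞) ≤ ⊤)
  have : LieGroup 𝓘(ℝ, F) (minSmoothness ℝ 3) G := LieGroup.of_le hsm
  have : IsManifold 𝓘(ℝ, F) 1 G := IsManifold.of_le (n := ∞) (by simp)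
  funext t
  obtain ⟨h0, hγ⟩ := (exists_isMIntegralCurve_mulInvariantVectorField (G := G) ξ).choose_spec
  obtain ⟨h0', hδ⟩ :=
    (exists_isMIntegralCurve_mulInvariantVectorField (G := G) (t • ξ)).choose_spec
  have hv := (contMDiff_mulInvariantVectorField (I := 𝓘(ℝ, F)) (G := G) (t • ξ)).of_le
    (n := minSmoothness ℝ 2) (m := 1) (by simp)
  -- Each `t • ξ` comes with its own chosen curve. Running the curve of `ξ` at speed `t` gives
  -- another integral curve for `t • ξ`; by uniqueness the two agree, in particular at time `1`.
  have hγt := hγ.comp_mul t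
  rw [← mulInvariantVectorField_smul] at hγt
  have e := isMIntegralCurve_Ioo_eq_of_contMDiff_boundaryless (t₀ := (0 : ℝ)) hv hδ hγt
    (by simp [h0, h0'])
  simpa [lieExp] using congrFun e 1

theorem lieExp_zero_smul (ξ : GroupLieAlgebra 𝓘(ℝ, F) G) : lieExp ((0 : ℝ) • ξ) = (1 : G) :=
  (congrFun (lieExp_smul_eq (G := G) ξ) 0).trans
    (exists_isMIntegralCurve_mulInvariantVectorField (G := G) ξ).choose_spec.1

theorem mdifferentiableAt_lieExp_smul (ξ : GroupLieAlgebra 𝓘(ℝ, F) G) (t : ℝ) :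
    MDifferentiableAt 𝓘(ℝ, ℝ) 𝓘(ℝ, F) (fun t : ℝ => (lieExp (t • ξ) : G)) t := by
  rw [lieExp_smul_eq]
  exact ((exists_isMIntegralCurve_mulInvariantVectorField (G := G) ξ).choose_spec.2
    t).mdifferentiableAt

end Exponential

/-! ### The action in charts -/

noncomputable section Charts

variable {F : Type*} [NormedAddCommGroup F] [NormedSpace ℝ F]
  {G : Type*} [TopologicalSpace G] [ChartedSpace F G] [Group G]
  {E : Type*} [NormedAddCommGroup E] [NormedSpace ℝ E]
  {Q : Type*} [TopologicalSpace Q] [ChartedSpace E Q] [IsManifold 𝓘(ℝ, E) ∞ Q]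
  [MulAction G Q] [ContMDiffSMul 𝓘(ℝ, F) 𝓘(ℝ, E) ∞ G Q]

variable (F G) in
/-- The action `(g, q') ↦ g • q'`, read in the preferred charts at `1 : G` and at `q : Q`. -/
def actionInCharts (q : Q) (z : F × E) : E :=
  extChartAt 𝓘(ℝ, E) q
    ((extChartAt 𝓘(ℝ, F) (1 : G)).symm z.1 • (extChartAt 𝓘(ℝ, E) q).symm z.2)

theorem contDiffAt_actionInCharts [LieGroup 𝓘(ℝ, F) ∞ G] (q : Q) :
    ContDiffAt ℝ ∞ (actionInCharts F G q)
      (extChartAt 𝓘(ℝ, F) (1 : G) 1, extChartAt 𝓘(ℝ, E) q q) := by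
  have h1 : ContMDiffAt 𝓘(ℝ, F) 𝓘(ℝ, F) ∞ (extChartAt 𝓘(ℝ, F) (1 : G)).symm
      (extChartAt 𝓘(ℝ, F) (1 : G) 1) :=
    (contMDiffOn_extChartAt_symm _).contMDiffAt (extChartAt_target_mem_nhds _)
  have h2 : ContMDiffAt 𝓘(ℝ, E) 𝓘(ℝ, E) ∞ (extChartAt 𝓘(ℝ, E) q).symm
      (extChartAt 𝓘(ℝ, E) q q) :=
    (contMDiffOn_extChartAt_symm _).contMDiffAt (extChartAt_target_mem_nhds _)
  have h12 := ContMDiffAt.prodMap' (p := (extChartAt 𝓘(ℝ, F) (1 : G) 1, extChartAt 𝓘(ℝ, E) q q))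
    h1 h2
  have h3 := (ContMDiffSMul.contMDiff_smul (I := 𝓘(ℝ, F)) (I' := 𝓘(ℝ, E)) (n := ∞)
    (G := G) (M := Q)).contMDiffAt.comp _ h12
  have h4 : ContMDiffAt 𝓘(ℝ, E) 𝓘(ℝ, E) ∞ (extChartAt 𝓘(ℝ, E) q) q := contMDiffAt_extChartAt
  have h5 := ContMDiffAt.comp_of_eq (g := extChartAt 𝓘(ℝ, E) q) h4 h3 (by simp)
  -- The product manifold structure on `F × E` is that of the vector space, so manifold smoothness
  -- becomes ordinary smoothness.
  rw [← modelWithCornersSelf_prod, chartedSpaceSelf_prod] at h5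
  exact contMDiffAt_iff_contDiffAt.1 h5

/-- Needed at nearby points too: the first-order chart formulas must hold as germs before they can
be differentiated again. -/
theorem eventually_differentiableAt_actionInCharts [LieGroup 𝓘(ℝ, F) ∞ G] (q : Q) :
    ∀ᶠ z in 𝓝 (extChartAt 𝓘(ℝ, F) (1 : G) 1, extChartAt 𝓘(ℝ, E) q q),
      DifferentiableAt ℝ (actionInCharts F G q) z := by
  have h := ((contDiffAt_actionInCharts (E := E) (F := F) (G := G) q).of_le
    (m := 1) (by exact_mod_cast le_top)).eventually (by simp)
  exact h.mono fun z hz => hz.differentiableAt (by simp)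

theorem hasFDerivAt_fderiv_actionInCharts [LieGroup 𝓘(ℝ, F) ∞ G] (q : Q) :
    HasFDerivAt (fderiv ℝ (actionInCharts F G q))
      (fderiv ℝ (fderiv ℝ (actionInCharts F G q))
        (extChartAt 𝓘(ℝ, F) (1 : G) 1, extChartAt 𝓘(ℝ, E) q q))
      (extChartAt 𝓘(ℝ, F) (1 : G) 1, extChartAt 𝓘(ℝ, E) q q) :=
  (((contDiffAt_actionInCharts (E := E) (F := F) (G := G) q).fderiv_right (m := 1)
    (by simpa using WithTop.coe_le_coe.2 (le_top : (1 + 1 : ℕ∞) ≤ ⊤))).differentiableAt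
      (by simp)).hasFDerivAt

theorem TangentBundle.trivializationAt_snd {q q' : Q}
    (h : q' ∈ (chartAt E q).source) (w : TangentSpace 𝓘(ℝ, E) q') :
    (trivializationAt E (TangentSpace 𝓘(ℝ, E)) q ⟨q', w⟩).2 =
      mfderiv 𝓘(ℝ, E) 𝓘(ℝ, E) (extChartAt 𝓘(ℝ, E) q) q' w := by
  have : IsManifold 𝓘(ℝ, E) 1 Q := IsManifold.of_le (n := ∞) (by simp)
  rw [← TangentBundle.continuousLinearMapAt_trivializationAt h]
  exact (congrFun (Trivialization.coe_linearMapAt_of_mem (R := ℝ)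
    (trivializationAt E (TangentSpace 𝓘(ℝ, E)) q) h) w).symm

/-- A vector-valued map which is `j` in the preferred chart at `x` has there the derivative
of `j`. -/
theorem HasFDerivAt.hasMFDerivAt_of_eventuallyEq_comp_extChartAt
    {V H M W : Type*} [NormedAddCommGroup V] [NormedSpace ℝ V] [TopologicalSpace H]
    {I : ModelWithCorners ℝ V H} [TopologicalSpace M] [ChartedSpace H M]
    [NormedAddCommGroup W] [NormedSpace ℝ W] {f : M → W} {x : M} {j : V → W} {j' : V →L[ℝ] W}
    (hj : HasFDerivAt j j' (extChartAt I x x)) (hf : f =ᶠ[𝓝 x] j ∘ extChartAt I x) :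
    HasMFDerivAt I 𝓘(ℝ, W) f x j' := by
  refine HasMFDerivAt.congr_of_eventuallyEq
    ⟨hj.continuousAt.comp (continuousAt_extChartAt x), ?_⟩ hf
  refine hj.hasFDerivWithinAt.congr_of_eventuallyEq ?_
    (congrArg j ((extChartAt I x).right_inv (mem_extChartAt_target x)))
  filter_upwards [extChartAt_target_mem_nhdsWithin x] with y hy
  exact congrArg j ((extChartAt I x).right_inv hy)

/-- For fixed `g`, the map `q' ↦ g • q'` followed by the chart is differentiated in two ways: by the
chain rule on manifolds, and as a partial map of `actionInCharts`. -/
theorem trivializationAt_tangentMap_smul {g : G} {q : Q}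
    (hg : g ∈ (chartAt F (1 : G)).source) (hgq : g • q ∈ (chartAt E q).source)
    (hd : DifferentiableAt ℝ (actionInCharts F G q)
      (extChartAt 𝓘(ℝ, F) (1 : G) g, extChartAt 𝓘(ℝ, E) q q)) (v : TangentSpace 𝓘(ℝ, E) q) :
    (trivializationAt E (TangentSpace 𝓘(ℝ, E)) q
      (tangentMap 𝓘(ℝ, E) 𝓘(ℝ, E) (fun q : Q => g • q) ⟨q, v⟩)).2 =
      fderiv ℝ (actionInCharts F G q)
        (extChartAt 𝓘(ℝ, F) (1 : G) g, extChartAt 𝓘(ℝ, E) q q) ((0 : F), (v : E)) := by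
  have : IsManifold 𝓘(ℝ, E) 1 Q := IsManifold.of_le (n := ∞) (by simp)
  have hs : MDifferentiableAt 𝓘(ℝ, E) 𝓘(ℝ, E) (fun q : Q => g • q) q :=
    (ContMDiffSMul.contMDiff_const_smul (I := 𝓘(ℝ, F)) (I' := 𝓘(ℝ, E)) (n := ∞) g
      ).contMDiffAt.mdifferentiableAt (by simp)
  have hA : HasFDerivAt (fun x => actionInCharts F G q (extChartAt 𝓘(ℝ, F) (1 : G) g, x))
      ((fderiv ℝ (actionInCharts F G q)
        (extChartAt 𝓘(ℝ, F) (1 : G) g, extChartAt 𝓘(ℝ, E) q q)).comp (.inr ℝ F E))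
      (extChartAt 𝓘(ℝ, E) q q) :=
    hd.hasFDerivAt.comp _ (hasFDerivAt_prodMk_right _ _)
  have hm := hA.hasMFDerivAt_of_eventuallyEq_comp_extChartAt (I := 𝓘(ℝ, E))
    (f := fun q' : Q => extChartAt 𝓘(ℝ, E) q (g • q')) (by
      filter_upwards [extChartAt_source_mem_nhds (I := 𝓘(ℝ, E)) q] with q' hq'
      simp only [Function.comp_apply, actionInCharts, (extChartAt 𝓘(ℝ, E) q).left_inv hq']
      rw [(extChartAt 𝓘(ℝ, F) (1 : G)).left_inv (by rwa [extChartAt_source])])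
  have hcomp := (mdifferentiableAt_extChartAt (I := 𝓘(ℝ, E)) hgq).hasMFDerivAt.comp q
    hs.hasMFDerivAt
  have e := hasMFDerivAt_unique hcomp hm
  exact (TangentBundle.trivializationAt_snd hgq _).trans (DFunLike.congr_fun e v)

end Charts

/-! ### The infinitesimal generator in charts -/

section GeneratorInCharts

variable {F : Type*} [NormedAddCommGroup F] [NormedSpace ℝ F] [FiniteDimensional ℝ F]
  {G : Type*} [TopologicalSpace G] [T2Space G] [ChartedSpace F G] [Group G]
  [LieGroup 𝓘(ℝ, F) ∞ G]
  {E : Type*} [NormedAddCommGroup E] [NormedSpace ℝ E]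
  {Q : Type*} [TopologicalSpace Q] [ChartedSpace E Q]
  [MulAction G Q]

theorem hasDerivAt_extChartAt_lieExp_smul (ξ : GroupLieAlgebra 𝓘(ℝ, F) G) :
    HasDerivAt (fun t : ℝ => extChartAt 𝓘(ℝ, F) (1 : G) (lieExp (t • ξ)))
      (deriv (fun t : ℝ => extChartAt 𝓘(ℝ, F) (1 : G) (lieExp (t • ξ))) 0) 0 := by
  have : IsManifold 𝓘(ℝ, F) 1 G := IsManifold.of_le (n := ∞) (by simp)
  have h : MDifferentiableAt 𝓘(ℝ, F) 𝓘(ℝ, F) (extChartAt 𝓘(ℝ, F) (1 : G)) 1 :=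
    mdifferentiableAt_extChartAt (mem_chart_source F 1)
  exact (mdifferentiableAt_iff_differentiableAt.1 (MDifferentiableAt.comp (0 : ℝ)
    (by rwa [lieExp_zero_smul]) (mdifferentiableAt_lieExp_smul ξ 0))).hasDerivAt

/-- The orbit curve is differentiable, so the `mfderiv` defining the generator is a true velocity
and not the default value zero. -/
theorem hasMFDerivAt_lieExp_smul_smul [ContMDiffSMul 𝓘(ℝ, F) 𝓘(ℝ, E) ∞ G Q]
    (ξ : GroupLieAlgebra 𝓘(ℝ, F) G) (q : Q) :
    HasMFDerivAt 𝓘(ℝ, ℝ) 𝓘(ℝ, E) (fun t : ℝ => (lieExp (t • ξ) : G) • q) 0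
      (ContinuousLinearMap.toSpanSingleton ℝ (infinitesimalGenerator ξ q : E)) := by
  have hd : MDifferentiableAt 𝓘(ℝ, F) 𝓘(ℝ, E) (fun g : G => g • q) (lieExp ((0 : ℝ) • ξ)) :=
    ((ContMDiffSMul.contMDiff_smul (I := 𝓘(ℝ, F)) (I' := 𝓘(ℝ, E)) (n := ∞) (G := G)
      (M := Q)).comp (contMDiff_id.prodMk contMDiff_const)).contMDiffAt.mdifferentiableAt (by simp)
  have h := (hd.comp 0 (mdifferentiableAt_lieExp_smul ξ 0)).hasMFDerivAt
  exact h.congr_mfderiv (ContinuousLinearMap.ext_ring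
    (ContinuousLinearMap.toSpanSingleton_apply_one ℝ _).symm)

theorem eventually_lieExp_smul_mem_chartAt_source (ξ : GroupLieAlgebra 𝓘(ℝ, F) G) :
    ∀ᶠ t in 𝓝 (0 : ℝ), (lieExp (t • ξ) : G) ∈ (chartAt F (1 : G)).source :=
  (mdifferentiableAt_lieExp_smul ξ 0).continuousAt.eventually (by
    beta_reduce
    rw [lieExp_zero_smul]
    exact chart_source_mem_nhds F (1 : G))

theorem hasDerivAt_extChartAt_lieExp_smul_smul (ξ : GroupLieAlgebra 𝓘(ℝ, F) G) {q q' : Q}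
    (hq' : q' ∈ (chartAt E q).source)
    (hd : DifferentiableAt ℝ (actionInCharts F G q)
      (extChartAt 𝓘(ℝ, F) (1 : G) 1, extChartAt 𝓘(ℝ, E) q q')) :
    HasDerivAt (fun t : ℝ => extChartAt 𝓘(ℝ, E) q ((lieExp (t • ξ) : G) • q'))
      (fderiv ℝ (actionInCharts F G q)
        (extChartAt 𝓘(ℝ, F) (1 : G) 1, extChartAt 𝓘(ℝ, E) q q')
        (deriv (fun t : ℝ => extChartAt 𝓘(ℝ, F) (1 : G) (lieExp (t • ξ))) 0, (0 : E))) 0 := by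
  have h := HasFDerivAt.comp_hasDerivAt_of_eq (0 : ℝ) hd.hasFDerivAt
    ((hasDerivAt_extChartAt_lieExp_smul (G := G) ξ).prodMk
      (hasDerivAt_const (0 : ℝ) (extChartAt 𝓘(ℝ, E) q q'))) (by simp only [lieExp_zero_smul])
  refine h.congr_of_eventuallyEq ?_
  filter_upwards [eventually_lieExp_smul_mem_chartAt_source ξ] with t ht
  simp only [Function.comp_apply, actionInCharts]
  rw [(extChartAt 𝓘(ℝ, F) (1 : G)).left_inv (by rwa [extChartAt_source]),
    (extChartAt 𝓘(ℝ, E) q).left_inv (by rwa [extChartAt_source])]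

theorem tangentMap_lieExp_zero_smul (ξ : GroupLieAlgebra 𝓘(ℝ, F) G)
    (v : TangentBundle 𝓘(ℝ, E) Q) :
    tangentMap 𝓘(ℝ, E) 𝓘(ℝ, E) (fun q : Q => (lieExp ((0 : ℝ) • ξ) : G) • q) v = v := by
  have h : (fun q : Q => (lieExp ((0 : ℝ) • ξ) : G) • q) = id := by
    funext q
    rw [lieExp_zero_smul, one_smul, id]
  rw [h, tangentMap_id, id]

/-- The velocity of the orbit curve, read in the chart at `q`, is computed once through the chart's
derivative and once through `actionInCharts`. Allowing `q' ≠ q` makes the generator a vector field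
near `q` in one fixed chart. -/
theorem trivializationAt_infinitesimalGenerator [IsManifold 𝓘(ℝ, E) ∞ Q]
    [ContMDiffSMul 𝓘(ℝ, F) 𝓘(ℝ, E) ∞ G Q]
    (ξ : GroupLieAlgebra 𝓘(ℝ, F) G) {q q' : Q}
    (hq' : q' ∈ (chartAt E q).source)
    (hd : DifferentiableAt ℝ (actionInCharts F G q)
      (extChartAt 𝓘(ℝ, F) (1 : G) 1, extChartAt 𝓘(ℝ, E) q q')) :
    (trivializationAt E (TangentSpace 𝓘(ℝ, E)) q ⟨q', infinitesimalGenerator ξ q'⟩).2 =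
      fderiv ℝ (actionInCharts F G q)
        (extChartAt 𝓘(ℝ, F) (1 : G) 1, extChartAt 𝓘(ℝ, E) q q')
        (deriv (fun t : ℝ => extChartAt 𝓘(ℝ, F) (1 : G) (lieExp (t • ξ))) 0, (0 : E)) := by
  have : IsManifold 𝓘(ℝ, E) 1 Q := IsManifold.of_le (n := ∞) (by simp)
  have h0 : (lieExp ((0 : ℝ) • ξ) : G) • q' = q' := by rw [lieExp_zero_smul, one_smul]
  let L : E →L[ℝ] E := mfderiv 𝓘(ℝ, E) 𝓘(ℝ, E) (extChartAt 𝓘(ℝ, E) q) q'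
  let X : E := infinitesimalGenerator ξ q'
  have hφ : HasMFDerivAt 𝓘(ℝ, E) 𝓘(ℝ, E) (extChartAt 𝓘(ℝ, E) q)
      ((lieExp ((0 : ℝ) • ξ) : G) • q') L := by
    rw [h0]
    exact (mdifferentiableAt_extChartAt hq').hasMFDerivAt
  have h1 : HasFDerivAt (fun t : ℝ => extChartAt 𝓘(ℝ, E) q ((lieExp (t • ξ) : G) • q'))
      (L.comp (ContinuousLinearMap.toSpanSingleton ℝ X)) 0 :=
    (HasMFDerivAt.comp (0 : ℝ) hφ (hasMFDerivAt_lieExp_smul_smul ξ q')).hasFDerivAt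
  have e := h1.hasDerivAt.unique (hasDerivAt_extChartAt_lieExp_smul_smul ξ hq' hd)
  rw [ContinuousLinearMap.comp_apply, ContinuousLinearMap.toSpanSingleton_apply_one] at e
  exact (TangentBundle.trivializationAt_snd hq' _).trans e

end GeneratorInCharts

/-! ### Infinitesimal action on the tangent bundle and derivative of the momentum -/

noncomputable section Derivatives

variable {F : Type*} [NormedAddCommGroup F] [NormedSpace ℝ F] [FiniteDimensional ℝ F]
  {G : Type*} [TopologicalSpace G] [T2Space G] [ChartedSpace F G] [Group G]
  [LieGroup 𝓘(ℝ, F) ∞ G]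
  {E : Type*} [NormedAddCommGroup E] [NormedSpace ℝ E]
  {Q : Type*} [TopologicalSpace Q] [ChartedSpace E Q] [IsManifold 𝓘(ℝ, E) ∞ Q]
  [MulAction G Q] [ContMDiffSMul 𝓘(ℝ, F) 𝓘(ℝ, E) ∞ G Q]

/-- The infinitesimal generator of `ξ`, read in the preferred chart at `q`. -/
def generatorInChart (ξ : GroupLieAlgebra 𝓘(ℝ, F) G) (q : Q) (x : E) : E :=
  fderiv ℝ (actionInCharts (E := E) F G q) (extChartAt 𝓘(ℝ, F) (1 : G) 1, x)
    (deriv (fun t : ℝ => extChartAt 𝓘(ℝ, F) (1 : G) (lieExp (t • ξ))) 0, (0 : E))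

theorem differentiableAt_generatorInChart (ξ : GroupLieAlgebra 𝓘(ℝ, F) G) (q : Q) :
    DifferentiableAt ℝ (generatorInChart (E := E) ξ q) (extChartAt 𝓘(ℝ, E) q q) := by
  have h := (hasFDerivAt_fderiv_actionInCharts (F := F) (G := G) q).comp
    (extChartAt 𝓘(ℝ, E) q q)
    (hasFDerivAt_prodMk_right (𝕜 := ℝ) (extChartAt 𝓘(ℝ, F) (1 : G) 1) (extChartAt 𝓘(ℝ, E) q q))
  exact (h.clm_apply (hasFDerivAt_const _ _)).differentiableAt

/-- The chain rule gives the second derivative with the direction `(0, v)` first; its symmetry swaps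
the arguments into the order produced by the tangent-lifted flow. -/
theorem fderiv_generatorInChart (ξ : GroupLieAlgebra 𝓘(ℝ, F) G) (q : Q) (v : E) :
    fderiv ℝ (generatorInChart (E := E) ξ q) (extChartAt 𝓘(ℝ, E) q q) v =
      fderiv ℝ (fderiv ℝ (actionInCharts F G q))
        (extChartAt 𝓘(ℝ, F) (1 : G) 1, extChartAt 𝓘(ℝ, E) q q)
        (deriv (fun t : ℝ => extChartAt 𝓘(ℝ, F) (1 : G) (lieExp (t • ξ))) 0, (0 : E))
        ((0 : F), v) := by
  have h := (hasFDerivAt_fderiv_actionInCharts (F := F) (G := G) q).comp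
    (extChartAt 𝓘(ℝ, E) q q)
    (hasFDerivAt_prodMk_right (𝕜 := ℝ) (extChartAt 𝓘(ℝ, F) (1 : G) 1) (extChartAt 𝓘(ℝ, E) q q))
  have h' := h.clm_apply (hasFDerivAt_const
    (deriv (fun t : ℝ => extChartAt 𝓘(ℝ, F) (1 : G) (lieExp (t • ξ))) 0, (0 : E)) _)
  have e : HasFDerivAt (generatorInChart (E := E) ξ q) _ _ := h'
  rw [e.fderiv, ((contDiffAt_actionInCharts (E := E) (F := F) (G := G) q).isSymmSndFDerivAt
    (by simpa using WithTop.coe_le_coe.2 (le_top : (2 : ℕ∞) ≤ ⊤))).eq]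
  simp

/-- At the base point of its own preferred chart, the tangent trivialization is the identity on the
fibre. -/
theorem generatorInChart_self (ξ : GroupLieAlgebra 𝓘(ℝ, F) G) (q : Q) :
    generatorInChart ξ q (extChartAt 𝓘(ℝ, E) q q) = infinitesimalGenerator ξ q := by
  have : IsManifold 𝓘(ℝ, E) 1 Q := IsManifold.of_le (n := ∞) (by simp)
  refine (trivializationAt_infinitesimalGenerator ξ (mem_chart_source E q)
    (eventually_differentiableAt_actionInCharts q).self_of_nhds).symm.trans ?_
  exact (tangentBundleCore 𝓘(ℝ, E) Q).coordChange_self (achart E q) q (mem_chart_source E q) _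

/-- A curve in `TQ` has the derivative of its components in the natural chart. -/
theorem hasMFDerivAt_tangentBundle_of_hasDerivAt {C : ℝ → TangentBundle 𝓘(ℝ, E) Q}
    {v : TangentBundle 𝓘(ℝ, E) Q} {t : ℝ} (hv : C t = v)
    (hc : ContinuousAt (fun t => (C t).proj) t) {a b : E}
    (ha : HasDerivAt (fun t => extChartAt 𝓘(ℝ, E) v.proj (C t).proj) a t)
    (hb : HasDerivAt
      (fun t => (trivializationAt E (TangentSpace 𝓘(ℝ, E)) v.proj (C t)).2) b t) :
    HasMFDerivAt 𝓘(ℝ, ℝ) 𝓘(ℝ, E).tangent C t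
      (ContinuousLinearMap.toSpanSingleton ℝ ((a, b) : E × E)) := by
  subst hv
  exact ⟨(FiberBundle.continuousAt_totalSpace E C).2 ⟨hc, hb.continuousAt⟩,
    (ha.prodMk hb).hasFDerivAt.hasFDerivWithinAt⟩

/-- The tangent lift of the one-parameter group of `ξ` has at `v ∈ T_qQ` the velocity
`(ξ_Q(q), Dξ_Q(q) v)` in the natural chart. -/
theorem hasMFDerivAt_tangentMap_lieExp_smul (ξ : GroupLieAlgebra 𝓘(ℝ, F) G)
    (v : TangentBundle 𝓘(ℝ, E) Q) :
    HasMFDerivAt 𝓘(ℝ, ℝ) 𝓘(ℝ, E).tangent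
      (fun t : ℝ => tangentMap 𝓘(ℝ, E) 𝓘(ℝ, E) (fun q : Q => (lieExp (t • ξ) : G) • q) v) 0
      (ContinuousLinearMap.toSpanSingleton ℝ
        ((infinitesimalGenerator ξ v.proj : E),
          fderiv ℝ (generatorInChart (E := E) ξ v.proj) (extChartAt 𝓘(ℝ, E) v.proj v.proj)
            (v.snd : E))) := by
  have hc := (hasMFDerivAt_lieExp_smul_smul (E := E) ξ v.proj).continuousAt
  have hq : ∀ᶠ t in 𝓝 (0 : ℝ), (lieExp (t • ξ) : G) • v.proj ∈ (chartAt E v.proj).source :=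
    hc.eventually (by
      beta_reduce
      rw [lieExp_zero_smul, one_smul]
      exact chart_source_mem_nhds E v.proj)
  have hcurve := (hasDerivAt_extChartAt_lieExp_smul (G := G) ξ).prodMk
    (hasDerivAt_const (0 : ℝ) (extChartAt 𝓘(ℝ, E) v.proj v.proj))
  have hd : ∀ᶠ t in 𝓝 (0 : ℝ), DifferentiableAt ℝ (actionInCharts F G v.proj)
      (extChartAt 𝓘(ℝ, F) (1 : G) (lieExp (t • ξ)), extChartAt 𝓘(ℝ, E) v.proj v.proj) :=
    hcurve.continuousAt.eventually (by
      beta_reduce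
      rw [lieExp_zero_smul]
      exact eventually_differentiableAt_actionInCharts (E := E) v.proj)
  refine hasMFDerivAt_tangentBundle_of_hasDerivAt (v := v)
    (tangentMap_lieExp_zero_smul ξ v) hc ?_ ?_
  · have h := hasDerivAt_extChartAt_lieExp_smul_smul ξ (mem_chart_source E v.proj)
      (eventually_differentiableAt_actionInCharts (E := E) (F := F) (G := G) v.proj).self_of_nhds
    exact h.congr_deriv (generatorInChart_self (E := E) ξ v.proj)
  · let w : E := v.snd
    refine HasDerivAt.congr_deriv ?_ (fderiv_generatorInChart (E := E) ξ v.proj w).symm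
    -- Near `t = 0` the fibre component is the partial derivative of the action in the direction
    -- `(0, w)`, taken at `(exp(tξ), q)`; differentiating in `t` gives the mixed second derivative.
    have h := HasFDerivAt.comp_hasDerivAt_of_eq (0 : ℝ)
      (hasFDerivAt_fderiv_actionInCharts (F := F) (G := G) v.proj) hcurve
      (by simp only [lieExp_zero_smul])
    have h' := h.clm_apply (hasDerivAt_const (0 : ℝ) ((0 : F), w))
    simp only [map_zero, add_zero] at h'
    refine h'.congr_of_eventuallyEq ?_
    filter_upwards [eventually_lieExp_smul_mem_chartAt_source ξ, hq, hd] with t h1 h2 h3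
    exact trivializationAt_tangentMap_smul h1 h2 h3 v.snd

theorem CotangentBundle.extChartAt_apply (α β : CotangentBundle 𝓘(ℝ, E) Q) :
    extChartAt (cotangentModel E) α β = (extChartAt 𝓘(ℝ, E) α.proj β.proj,
      β.snd.comp ((trivializationAt E (TangentSpace 𝓘(ℝ, E)) α.proj).symmL ℝ β.proj)) := by
  rw [FiberBundle.extChartAt]
  refine Prod.ext rfl (ContinuousLinearMap.ext fun w => ?_)
  simp [hom_trivializationAt_apply, ContinuousLinearMap.inCoordinates]

theorem CotangentBundle.extChartAt_self (α : CotangentBundle 𝓘(ℝ, E) Q) :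
    extChartAt (cotangentModel E) α α =
      (extChartAt 𝓘(ℝ, E) α.proj α.proj, (α.snd : E →L[ℝ] ℝ)) := by
  have : IsManifold 𝓘(ℝ, E) 1 Q := IsManifold.of_le (n := ∞) (by simp)
  rw [CotangentBundle.extChartAt_apply,
    TangentBundle.symmL_trivializationAt_eq_core (mem_chart_source E _)]
  refine Prod.ext rfl (ContinuousLinearMap.ext fun w => congrArg α.snd ?_)
  exact (tangentBundleCore 𝓘(ℝ, E) Q).coordChange_self (achart E α.proj) α.proj
    (mem_chart_source E _) w

/-- In natural coordinates `J_ξ(q, p) = p (ξ_Q(q))` and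
`dJ_ξ = p ∘ Dξ_Q dq + ξ_Q dp`. -/
theorem hasMFDerivAt_momentumComponent (ξ : GroupLieAlgebra 𝓘(ℝ, F) G)
    (α : CotangentBundle 𝓘(ℝ, E) Q) :
    HasMFDerivAt (cotangentModel E) 𝓘(ℝ, ℝ) (momentumComponent (E := E) ξ) α
      ((((α.snd : E →L[ℝ] ℝ).comp
          (fderiv ℝ (generatorInChart (E := E) ξ α.proj) (extChartAt 𝓘(ℝ, E) α.proj α.proj))).coprod
        (ContinuousLinearMap.apply ℝ ℝ (infinitesimalGenerator ξ α.proj : E))) :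
          E × (E →L[ℝ] ℝ) →L[ℝ] ℝ) := by
  have : IsManifold 𝓘(ℝ, E) 1 Q := IsManifold.of_le (n := ∞) (by simp)
  have hY := (differentiableAt_generatorInChart (E := E) ξ α.proj).hasFDerivAt
  let p : E →L[ℝ] ℝ := α.snd
  have hj : HasFDerivAt (fun z : E × (E →L[ℝ] ℝ) => z.2 (generatorInChart ξ α.proj z.1))
      ((p.comp (fderiv ℝ (generatorInChart (E := E) ξ α.proj)
          (extChartAt 𝓘(ℝ, E) α.proj α.proj))).coprod
        (ContinuousLinearMap.apply ℝ ℝ (infinitesimalGenerator ξ α.proj : E)))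
      (extChartAt 𝓘(ℝ, E) α.proj α.proj, p) := by
    refine ((hasFDerivAt_snd (𝕜 := ℝ) (E := E) (F := E →L[ℝ] ℝ)).clm_apply
      (HasFDerivAt.comp (f := Prod.fst) (extChartAt 𝓘(ℝ, E) α.proj α.proj, p) hY
        (hasFDerivAt_fst (𝕜 := ℝ) (E := E)))).congr_fderiv (ContinuousLinearMap.ext fun z => ?_)
    rw [← generatorInChart_self]
    simp
  refine HasFDerivAt.hasMFDerivAt_of_eventuallyEq_comp_extChartAt (I := cotangentModel E)
    ((CotangentBundle.extChartAt_self α).symm ▸ hj) ?_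
  have hproj : ContinuousAt (fun β : CotangentBundle 𝓘(ℝ, E) Q => β.proj) α :=
    (FiberBundle.continuous_proj (E →L[ℝ] ℝ)
      (fun x : Q => TangentSpace 𝓘(ℝ, E) x →L[ℝ] ℝ)).continuousAt
  have hd : ∀ᶠ β : CotangentBundle 𝓘(ℝ, E) Q in 𝓝 α,
      DifferentiableAt ℝ (actionInCharts F G α.proj)
        (extChartAt 𝓘(ℝ, F) (1 : G) 1, extChartAt 𝓘(ℝ, E) α.proj β.proj) :=
    (continuousAt_const.prodMk ((continuousAt_extChartAt α.proj).comp hproj)).eventually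
      (eventually_differentiableAt_actionInCharts (E := E) (F := F) (G := G) α.proj)
  filter_upwards [hproj.eventually (chart_source_mem_nhds E α.proj), hd] with β h1 h2
  rw [Function.comp_apply, CotangentBundle.extChartAt_apply]
  refine congrArg β.snd ?_
  have e := trivializationAt_infinitesimalGenerator ξ h1 h2
  -- The momentum coordinate is `β.snd` composed with the inverse trivialization, which takes the
  -- chart form of the generator back to `ξ_Q(β.proj)`.
  have e' := (trivializationAt E (TangentSpace 𝓘(ℝ, E)) α.proj).symmL_continuousLinearMapAt
    (R := ℝ) h1 (infinitesimalGenerator ξ β.proj)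
  rw [TangentBundle.continuousLinearMapAt_trivializationAt h1] at e'
  exact e'.symm.trans (congrArg _ ((TangentBundle.trivializationAt_snd h1 _).symm.trans e))

end Derivatives

/-! ### Infinitesimal symmetry of the discretization map and of the Hamiltonian -/

noncomputable section Symmetry

variable {F : Type*} [NormedAddCommGroup F] [NormedSpace ℝ F] [FiniteDimensional ℝ F]
  {G : Type*} [TopologicalSpace G] [T2Space G] [ChartedSpace F G] [Group G]
  [LieGroup 𝓘(ℝ, F) ∞ G]
  {E : Type*} [NormedAddCommGroup E] [NormedSpace ℝ E]
  {Q : Type*} [TopologicalSpace Q] [ChartedSpace E Q] [IsManifold 𝓘(ℝ, E) ∞ Q]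
  [MulAction G Q] [ContMDiffSMul 𝓘(ℝ, F) 𝓘(ℝ, E) ∞ G Q]

/-- A symmetry-preserving map relates the infinitesimal generators on `TQ` and on `Q × Q`. -/
theorem IsSymmetryPreserving.mfderiv_infinitesimalGenerator
    {U : Set (TangentBundle 𝓘(ℝ, E) Q)} {R : TangentBundle 𝓘(ℝ, E) Q → Q × Q}
    (hsymm : IsSymmetryPreserving G U R) (hU : IsOpen U) {v : TangentBundle 𝓘(ℝ, E) Q}
    (hv : v ∈ U)
    (hR : MDifferentiableAt 𝓘(ℝ, E).tangent (𝓘(ℝ, E).prod 𝓘(ℝ, E)) R v)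
    (ξ : GroupLieAlgebra 𝓘(ℝ, F) G) :
    (mfderiv 𝓘(ℝ, E).tangent (𝓘(ℝ, E).prod 𝓘(ℝ, E)) R v : E × E →L[ℝ] E × E)
        ((infinitesimalGenerator ξ v.proj : E),
          fderiv ℝ (generatorInChart (E := E) ξ v.proj) (extChartAt 𝓘(ℝ, E) v.proj v.proj)
            (v.snd : E)) =
      ((infinitesimalGenerator ξ (R v).1 : E), (infinitesimalGenerator ξ (R v).2 : E)) := by
  let C : ℝ → TangentBundle 𝓘(ℝ, E) Q := fun t =>
    tangentMap 𝓘(ℝ, E) 𝓘(ℝ, E) (fun q : Q => (lieExp (t • ξ) : G) • q) v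
  have hC0 : C 0 = v := tangentMap_lieExp_zero_smul ξ v
  let L : E × E →L[ℝ] E × E := mfderiv 𝓘(ℝ, E).tangent (𝓘(ℝ, E).prod 𝓘(ℝ, E)) R v
  have hRC : HasMFDerivAt 𝓘(ℝ, E).tangent (𝓘(ℝ, E).prod 𝓘(ℝ, E)) R (C 0) L := by
    rw [hC0]
    exact hR.hasMFDerivAt
  have hC := hasMFDerivAt_tangentMap_lieExp_smul ξ v
  have h1 := HasMFDerivAt.comp (0 : ℝ) hRC hC
  have h2 := (hasMFDerivAt_lieExp_smul_smul (E := E) ξ (R v).1).prodMk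
    (hasMFDerivAt_lieExp_smul_smul (E := E) ξ (R v).2)
  have hCU : ∀ᶠ t in 𝓝 (0 : ℝ), C t ∈ U :=
    hC.continuousAt.eventually (hU.mem_nhds (hC0.symm ▸ hv : C 0 ∈ U))
  have h3 := h2.congr_of_eventuallyEq (f₁ := R ∘ C)
    (hCU.mono fun t ht => hsymm (lieExp (t • ξ)) v hv ht)
  have e := DFunLike.congr_fun (hasMFDerivAt_unique h1 h3) (1 : ℝ)
  have e1 : L ((1 : ℝ) • ((infinitesimalGenerator ξ v.proj : E),
      fderiv ℝ (generatorInChart (E := E) ξ v.proj) (extChartAt 𝓘(ℝ, E) v.proj v.proj)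
        (v.snd : E))) =
      ((1 : ℝ) • (infinitesimalGenerator ξ (R v).1 : E),
        (1 : ℝ) • (infinitesimalGenerator ξ (R v).2 : E)) := e
  rwa [one_smul, one_smul, one_smul] at e1

/-- `X_H(J_ξ) = 0` in natural coordinates: `p (Dξ_Q ∂H/∂p) = ∂H/∂q (ξ_Q)`. -/
theorem IsConstantOfMotion.fderiv_generatorInChart_eq [FiniteDimensional ℝ E]
    {H : CotangentBundle 𝓘(ℝ, E) Q → ℝ} {ξ : GroupLieAlgebra 𝓘(ℝ, F) G}
    (hJ : IsConstantOfMotion H (momentumComponent (E := E) (Q := Q) ξ))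
    (α : CotangentBundle 𝓘(ℝ, E) Q) {dH : E × (E →L[ℝ] ℝ) →L[ℝ] ℝ}
    (hdH : dH = mfderiv (cotangentModel E) 𝓘(ℝ, ℝ) H α) :
    (α.snd : E →L[ℝ] ℝ) (fderiv ℝ (generatorInChart (E := E) ξ α.proj)
        (extChartAt 𝓘(ℝ, E) α.proj α.proj)
        ((bidualEquiv E).symm (dH.comp (.inr ℝ E (E →L[ℝ] ℝ))))) =
      dH ((infinitesimalGenerator ξ α.proj : E), 0) := by
  subst hdH
  have e := hJ α
  simp only [differential] at e
  rw [(hasMFDerivAt_momentumComponent ξ α).mfderiv] at e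
  -- `dJ_ξ` evaluated on `(∂H/∂p, -∂H/∂q)` unfolds to `p(Dξ_Q ∂H/∂p) + -(∂H/∂q(ξ_Q))`.
  exact add_neg_eq_zero.1 e

/-- Scaling acts on `μ_q` and `μ_p` but not on the base point, so after the flip `h` multiplies the
vector and the first covector component while `p` is unscaled. -/
theorem canonicalFlip_fiberSmul_differential [FiniteDimensional ℝ E]
    (H : CotangentBundle 𝓘(ℝ, E) Q → ℝ) (h : ℝ) (α : CotangentBundle 𝓘(ℝ, E) Q)
    {dH : E × (E →L[ℝ] ℝ) →L[ℝ] ℝ} (hdH : dH = mfderiv (cotangentModel E) 𝓘(ℝ, ℝ) H α) :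
    canonicalFlip (fiberSmul h (differential (cotangentModel E) H α)) =
      ⟨⟨α.proj, h • (bidualEquiv E).symm (dH.comp (.inr ℝ E (E →L[ℝ] ℝ)))⟩,
        ((-(h • dH.comp (.inl ℝ E (E →L[ℝ] ℝ)))).coprod (α.snd : E →L[ℝ] ℝ) :
          E × E →L[ℝ] ℝ)⟩ := by
  subst hdH
  rw [← LinearEquiv.map_smul]
  rfl

/-- Only `φ ∘ T_vR = λ` enters, never an inverse of `T_vR`: `λ` is evaluated on vectors whose image
under `T_vR` is known. -/
theorem IsCotangentLift.covectorPair_apply {U : Set (TangentBundle 𝓘(ℝ, E) Q)}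
    {R : TangentBundle 𝓘(ℝ, E) Q → Q × Q}
    {lam : CotangentBundle 𝓘(ℝ, E).tangent (TangentBundle 𝓘(ℝ, E) Q)}
    {μ ν : CotangentBundle 𝓘(ℝ, E) Q} (hl : IsCotangentLift U R lam (covectorPair μ ν)) :
    R lam.proj = (μ.proj, ν.proj) ∧
      ∀ z w : E × E,
      (mfderiv 𝓘(ℝ, E).tangent (𝓘(ℝ, E).prod 𝓘(ℝ, E)) R lam.proj : E × E →L[ℝ] E × E) z = w →
      (lam.snd : E × E →L[ℝ] ℝ) z =
        (μ.snd : E →L[ℝ] ℝ) w.1 + (ν.snd : E →L[ℝ] ℝ) w.2 := by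
  obtain ⟨-, φ, hφ, hlam⟩ := hl
  have h1 := congrArg TotalSpace.proj hφ
  let f : CotangentBundle (𝓘(ℝ, E).prod 𝓘(ℝ, E)) (Q × Q) → (E × E →L[ℝ] ℝ) := fun β => β.snd
  have h2 : (μ.snd : E →L[ℝ] ℝ).coprod (ν.snd : E →L[ℝ] ℝ) = (φ : E × E →L[ℝ] ℝ) :=
    congrArg f hφ
  refine ⟨h1.symm, fun z w hz => ?_⟩
  have h3 := DFunLike.congr_fun hlam z
  have h4 := DFunLike.congr_fun h2 w
  subst hz
  exact h3.symm.trans h4.symm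

end Symmetry

/-! ### Conservation of the momentum -/

theorem theorem1
    {E : Type*} [NormedAddCommGroup E] [NormedSpace ℝ E] [FiniteDimensional ℝ E]
    {Q : Type*} [TopologicalSpace Q] [ChartedSpace E Q] [IsManifold 𝓘(ℝ, E) ∞ Q]
    {F : Type*} [NormedAddCommGroup F] [NormedSpace ℝ F] [FiniteDimensional ℝ F]
    {G : Type*} [TopologicalSpace G] [T2Space G] [ChartedSpace F G] [Group G]
    [LieGroup 𝓘(ℝ, F) ∞ G] [MulAction G Q] [ContMDiffSMul 𝓘(ℝ, F) 𝓘(ℝ, E) ∞ G Q]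
    [ProperSMul G Q] (hfree : ∀ (g : G) (q : Q), g • q = q → g = 1)
    (U : Set (TangentBundle 𝓘(ℝ, E) Q)) (R : TangentBundle 𝓘(ℝ, E) Q → Q × Q)
    (hR : IsDiscretizationMap U R) (hsymm : IsSymmetryPreserving G U R)
    (H : CotangentBundle 𝓘(ℝ, E) Q → ℝ) (hH : ContMDiff (cotangentModel E) 𝓘(ℝ, ℝ) ∞ H)
    (ξ : GroupLieAlgebra 𝓘(ℝ, F) G)
    (hJ : IsConstantOfMotion H (momentumComponent (E := E) (Q := Q) ξ))
    (h : ℝ) (hh : 0 < h) (μ ν : CotangentBundle 𝓘(ℝ, E) Q)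
    (hD : covectorPair (fiberSmul (-1) μ) ν ∈ discreteDynamics U R H h) :
    momentumComponent ξ μ = momentumComponent ξ ν := by
  obtain ⟨_, ⟨_, ⟨α, rfl⟩, rfl⟩, hlift⟩ := hD
  rw [canonicalFlip_fiberSmul_differential H h α rfl] at hlift
  have hvU := hlift.1
  obtain ⟨hRv, hpair⟩ := hlift.covectorPair_apply
  have hR' := (hR.contMDiffOn.contMDiffAt (hR.isOpen.mem_nhds hvU)).mdifferentiableAt (by simp)
  have e := hpair _ _ (hsymm.mfderiv_infinitesimalGenerator hR.isOpen hvU hR' ξ)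
  -- The generators in `e` sit at the components of `R v`, which are only propositionally equal to
  -- the base points of `μ` and `ν`; a free `x` makes the substitution possible.
  have hgen (β : CotangentBundle 𝓘(ℝ, E) Q) (x : Q) (hx : x = β.proj) :
      (β.snd : E →L[ℝ] ℝ) (infinitesimalGenerator ξ x : E) = momentumComponent ξ β := by
    subst hx
    rfl
  have hμ := hgen (fiberSmul (-1) μ) _ (congrArg Prod.fst hRv)
  have hν := hgen ν _ (congrArg Prod.snd hRv)
  have e' := e.trans (congrArg₂ (· + ·) hμ hν)
  let dH : E × (E →L[ℝ] ℝ) →L[ℝ] ℝ := mfderiv (cotangentModel E) 𝓘(ℝ, ℝ) H α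
  let p : E →L[ℝ] ℝ := α.snd
  let X : E := infinitesimalGenerator ξ α.proj
  let D : E →L[ℝ] E :=
    fderiv ℝ (generatorInChart (E := E) ξ α.proj) (extChartAt 𝓘(ℝ, E) α.proj α.proj)
  let w : E := (bidualEquiv E).symm (dH.comp (.inr ℝ E (E →L[ℝ] ℝ)))
  -- The left side is `λ` on the lifted velocity at `v = h • w`; the `-1` is the sign in `(-μ, ν)`.
  have hbal : -(h * dH (X, 0)) + p (D (h • w)) =
      (-1) * momentumComponent ξ μ + momentumComponent ξ ν := e'
  have hmot : p (D w) = dH (X, 0) := hJ.fderiv_generatorInChart_eq α rfl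
  rw [map_smul, map_smul, smul_eq_mul, hmot] at hbal
  linarith
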